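/- Let $n\geq 1$ and let $\mathrm{Conv}_c(\mathbb{R}^n)$ be the set of convex functions $\psi\colon\mathbb{R}^n\to(-\infty,\infty]$ that are coercive ($\psi(x)\to\infty$ as $|x|\to\infty$), proper ($\psi\not\equiv\infty$) and lower semicontinuous. For such $\psi$ let $\psi^*(x)=\sup_{y\in\mathbb{R}^n}(\langle x,y\rangle-\psi(y))$ be its convex conjugate, $\operatorname{dom}\psi^*=\{x:\psi^*(x)<\infty\}$, and $$r(\psi)=\sup\{r\geq 0:\ rB_n\subseteq\operatorname{dom}\psi^*\}\in(0,\infty],$$ where $B_n$ is the closed Euclidean unit ball. For $n\geq 2$ let the rotational epi-symmetrization $\psi_{\rm rot}$ be the unique function in $\mathrm{Conv}_c(\mathbb{R}^n)$ with $$(\psi_{\rm rot})^*(x)=\int_{\mathrm{SO}(n)}\psi^*(\vartheta^{-1}x)\,d\vartheta,\qquad x\in\mathbb{R}^n,$$ the integral being taken with respect to the Haar probability measure (equivalently, $\psi_{\rm rot}$ is the convex conjugate of the function on the right-hand side). For $n=1$ let $\psi_{\rm rot}(x)=\tfrac12\inf_{y\in\mathbb{R}}\big(\psi(2x-y)+\psi(-y)\big)$.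 Let $\mu$ be a Borel probability measure on $\mathbb{R}^n$ with compact support, $R_\mu=\sup_{y\in\operatorname{supp}\mu}|y|$, and write $\Phi_{\rm avg}(\varphi,\mu)=\int_{\mathbb{R}^n}\varphi^*\,d\mu$. Let $\psi\in\mathrm{Conv}_c(\mathbb{R}^n)$ satisfy $r(\psi)>R_\mu$. If $n\geq 2$, then $\Phi_{\rm avg}(\psi\circ\vartheta^{-1},\mu)$, for every $\vartheta\in\mathrm{SO}(n)$, and $\Phi_{\rm avg}(\psi_{\rm rot},\mu)$ are finite, and there exists $\vartheta_o\in\mathrm{SO}(n)$ such that $$\Phi_{\rm avg}(\psi\circ\vartheta_o^{-1},\mu)=\min_{\vartheta\in\mathrm{SO}(n)}\Phi_{\rm avg}(\psi\circ\vartheta^{-1},\mu)\leq\Phi_{\rm avg}(\psi_{\rm rot},\mu).$$ For $n=1$ the same statement holds with $\mathrm{O}(1)=\{\pm1\}$ in place of $\mathrm{SO}(1)$. -/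

import Mathlib

open MeasureTheory Filter Topology
open scoped ENNReal NNReal

/-- `ℝⁿ` with its Euclidean norm and inner product. -/
abbrev EucSp (n : ℕ) : Type := EuclideanSpace ℝ (Fin n)

/-! ### Coercive convex functions and their conjugates -/

/-- The class `Conv_c(ℝⁿ)`: convex functions `ψ : ℝⁿ → (-∞, ∞]` that are coercive, proper and
lower semicontinuous. -/
structure IsConvC {n : ℕ} (ψ : EucSp n → EReal) : Prop where
  ne_bot : ∀ x, ψ x ≠ ⊥
  convex : ∀ x y : EucSp n, ∀ a b : ℝ, 0 < a → 0 < b → a + b = 1 →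
    ψ (a • x + b • y) ≤ (a : EReal) * ψ x + (b : EReal) * ψ y
  coercive : Tendsto ψ (Bornology.cobounded (EucSp n)) (𝓝 ⊤)
  proper : ∃ x, ψ x < ⊤
  lsc : LowerSemicontinuous ψ

/-- The convex conjugate (Legendre–Fenchel transform) `ψ*(x) = sup_y (⟨x, y⟩ - ψ(y))`. -/
noncomputable def leg {n : ℕ} (ψ : EucSp n → EReal) : EucSp n → EReal :=
  fun x => ⨆ y : EucSp n, ((inner ℝ x y : ℝ) : EReal) - ψ y

/-- The domain `dom ψ = {x : ψ(x) < ∞}`. -/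
def effDom {n : ℕ} (ψ : EucSp n → EReal) : Set (EucSp n) := {x | ψ x < ⊤}

/-- `r(ψ) = sup {r ≥ 0 : r Bₙ ⊆ dom ψ*}`, an element of `[0, ∞]`. -/
noncomputable def slopeRadius {n : ℕ} (ψ : EucSp n → EReal) : ℝ≥0∞ :=
  ⨆ r : {r : ℝ≥0 // Metric.closedBall (0 : EucSp n) r ⊆ effDom (leg ψ)}, ((r : ℝ≥0) : ℝ≥0∞)

/-- `R_μ = sup {|y| : y ∈ supp μ}`, as an element of `[0, ∞]`; it is finite if the support is
compact. -/
noncomputable def suppRadius {n : ℕ} (μ : Measure (EucSp n)) : ℝ≥0∞ :=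
  ⨆ y ∈ μ.support, ‖y‖ₑ

/-! ### Integrals of extended real functions -/

/-- The integral of an extended real function: the integral of the positive part minus the
integral of the negative part. This is the usual integral, with values in `[-∞, ∞]`, as soon as one
of the two is finite; so it is, in particular, for a measurable function that is bounded below
almost everywhere and a finite measure. -/
noncomputable def extIntegral {α : Type*} [MeasurableSpace α] (μ : Measure α) (f : α → EReal) :
    EReal :=
  ((∫⁻ x, (f x).toENNReal ∂μ : ℝ≥0∞) : EReal) - ((∫⁻ x, (-f x).toENNReal ∂μ : ℝ≥0∞) : EReal)

/-- `Φ_avg(ψ, μ) = ∫ ψ* dμ`. -/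
noncomputable def PhiAvg {n : ℕ} (ψ : EucSp n → EReal) (μ : Measure (EucSp n)) : EReal :=
  extIntegral μ (leg ψ)

/-! ### Rotations and Haar measure -/

/-- The orthogonal group `O(n)`. -/
abbrev OGrp (n : ℕ) : Submonoid (Matrix (Fin n) (Fin n) ℝ) := Matrix.orthogonalGroup (Fin n) ℝ

/-- The rotation group `SO(n)`. -/
abbrev SOGrp (n : ℕ) : Submonoid (Matrix (Fin n) (Fin n) ℝ) :=
  Matrix.specialOrthogonalGroup (Fin n) ℝ

/-- `ψ ∘ A⁻¹`, for an invertible matrix `A`. -/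
noncomputable def compInv {n : ℕ} (ψ : EucSp n → EReal) (A : Matrix (Fin n) (Fin n) ℝ) :
    EucSp n → EReal :=
  fun x => ψ (Matrix.toEuclideanLin A⁻¹ x)

theorem SOGrp_mem_iff {n : ℕ} (A : Matrix (Fin n) (Fin n) ℝ) :
    A ∈ SOGrp n ↔ A * A.transpose = 1 ∧ A.det = 1 := by
  rw [Matrix.mem_specialOrthogonalGroup_iff, Matrix.mem_orthogonalGroup_iff]

theorem isCompact_SOGrp (n : ℕ) : IsCompact (SOGrp n : Set (Matrix (Fin n) (Fin n) ℝ)) := by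
  have hcl : IsClosed (SOGrp n : Set (Matrix (Fin n) (Fin n) ℝ)) := by
    have : (SOGrp n : Set (Matrix (Fin n) (Fin n) ℝ)) =
        {A | A * A.transpose = 1} ∩ {A | A.det = 1} := by
      ext A
      exact SOGrp_mem_iff A
    rw [this]
    refine IsClosed.inter (isClosed_eq ?_ continuous_const) (isClosed_eq ?_ continuous_const)
    · exact continuous_id.mul continuous_id.matrix_transpose
    · exact continuous_id.matrix_det
  have hbox : IsCompact (Set.pi Set.univ (fun _ : Fin n => Set.pi Set.univ
      (fun _ : Fin n => Set.Icc (-1 : ℝ) 1)) : Set (Fin n → Fin n → ℝ)) :=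
    isCompact_univ_pi fun _ => isCompact_univ_pi fun _ => isCompact_Icc
  refine IsCompact.of_isClosed_subset hbox hcl ?_
  intro A hA i _ j _
  have h1 := congrFun (congrFun ((SOGrp_mem_iff A).1 hA).1 i) i
  rw [Matrix.mul_apply, Matrix.one_apply_eq] at h1
  simp only [Matrix.transpose_apply] at h1
  have h2 : A i j * A i j ≤ 1 := by
    rw [← h1]
    exact Finset.single_le_sum (f := fun k => A i k * A i k)
      (fun k _ => mul_self_nonneg _) (Finset.mem_univ j)
  constructor <;> nlinarith

instance instCompactSpaceSOGrp (n : ℕ) : CompactSpace (SOGrp n) :=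
  isCompact_iff_compactSpace.1 (isCompact_SOGrp n)

instance instTopGroupSOGrp (n : ℕ) : IsTopologicalGroup (SOGrp n) where
  continuous_inv := by
    refine Continuous.subtype_mk (f := fun A : SOGrp n => (A : Matrix (Fin n) (Fin n) ℝ).transpose)
      ?_ _
    exact continuous_subtype_val.matrix_transpose

/-- `SO(n)` carries its Borel `σ`-algebra. -/
instance instMeasurableSpaceSOGrp (n : ℕ) : MeasurableSpace (SOGrp n) := borel _

instance instBorelSpaceSOGrp (n : ℕ) : BorelSpace (SOGrp n) := ⟨rfl⟩

/-- The Haar probability measure on `SO(n)`. -/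
noncomputable def haarSO (n : ℕ) : Measure (SOGrp n) :=
  Measure.haarMeasure ⊤

instance instIsProbabilityMeasureHaarSO (n : ℕ) : IsProbabilityMeasure (haarSO n) :=
  ⟨Measure.haarMeasure_self (K₀ := (⊤ : TopologicalSpace.PositiveCompacts (SOGrp n)))⟩

/-! ### Rotational epi-symmetrization -/

/-- The infimal convolution `(ψ₁ □ ψ₂)(x) = inf_y (ψ₁(x - y) + ψ₂(y))`. -/
noncomputable def infConv {n : ℕ} (ψ₁ ψ₂ : EucSp n → EReal) : EucSp n → EReal :=
  fun x => ⨅ y : EucSp n, ψ₁ (x - y) + ψ₂ y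

/-- Epi-multiplication `x ↦ c ψ(x / c)`, for `c > 0`. -/
noncomputable def epiMul {n : ℕ} (c : ℝ) (ψ : EucSp n → EReal) : EucSp n → EReal :=
  fun x => (c : EReal) * ψ (c⁻¹ • x)

/-- The rotational mean of the conjugate, `x ↦ ∫_{SO(n)} ψ*(ϑ⁻¹ x) dϑ`. -/
noncomputable def legRotMean {n : ℕ} (ψ : EucSp n → EReal) : EucSp n → EReal :=
  fun x => extIntegral (haarSO n)
    (fun ϑ : SOGrp n => compInv (leg ψ) (ϑ : Matrix (Fin n) (Fin n) ℝ) x)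

/-- The rotational epi-symmetrization `ψ_rot`. For `n ≥ 2` it is the function in `Conv_c(ℝⁿ)` whose
conjugate is the rotational mean of `ψ*`; as conjugation is an involution on proper lower
semicontinuous convex functions, it is the conjugate of that mean. For `n = 1` it is
`½ · (ψ □ ψ⁻)`, with `ψ⁻(x) = ψ(-x)` and with epi-multiplication. -/
noncomputable def psiRot {n : ℕ} (ψ : EucSp n → EReal) : EucSp n → EReal :=
  if n = 1 then epiMul (1 / 2) (infConv ψ (fun x => ψ (-x))) else leg (legRotMean ψ)

/-! ### Integrals of extended real functions -/

/-! As `R_μ < r(ψ)`, some open ball of radius `ρ` carries `μ` while `ψ*` is finite on a larger ball.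
There `ψ*` is convex, hence continuous, and on the closed `ρ`-ball it equals a bounded continuous
`H` (`exists_boundedContinuous_eq_leg`). So the functional of the rotated function is `F(A) = ∫
H(Aᵀx) dμ`, finite and continuous in `A`, and it attains its minimum on the compact group `SO(n)`.
By Fubini the value at `ψ_rot` is the Haar mean of `F`, which is at least the minimum.

The delicate point is that `ψ_rot` is itself a conjugate: `(ψ_rot)*` is the biconjugate of the
rotational mean, and it must be shown to equal that mean on the open ball (`leg_leg_eq`,
`leg_leg_legRotMean`). For `n = 1` the conjugate is computed directly as the mean of `ψ*(x)` and
`ψ*(-x)` (`leg_epiMul_infConv`). -/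

theorem extIntegral_mono {α : Type*} [MeasurableSpace α] (μ : Measure α) {f g : α → EReal}
    (h : ∀ x, f x ≤ g x) : extIntegral μ f ≤ extIntegral μ g := by
  refine EReal.sub_le_sub ?_ ?_
  · exact EReal.coe_ennreal_le_coe_ennreal_iff.2
      (lintegral_mono fun x => EReal.toENNReal_le_toENNReal (h x))
  · exact EReal.coe_ennreal_le_coe_ennreal_iff.2
      (lintegral_mono fun x => EReal.toENNReal_le_toENNReal (EReal.neg_le_neg_iff.2 (h x)))

theorem extIntegral_eq_coe_integral {α : Type*} [MeasurableSpace α] {μ : Measure α}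
    {f : α → EReal} {h : α → ℝ} (hh : Integrable h μ) (hfh : ∀ᵐ x ∂μ, f x = (h x : EReal)) :
    extIntegral μ f = ((∫ x, h x ∂μ : ℝ) : EReal) := by
  have h1 : ∫⁻ x, (f x).toENNReal ∂μ = ∫⁻ x, ENNReal.ofReal (h x) ∂μ := by
    refine lintegral_congr_ae ?_
    filter_upwards [hfh] with x hx
    rw [hx, EReal.real_coe_toENNReal]
  have h2 : ∫⁻ x, (-f x).toENNReal ∂μ = ∫⁻ x, ENNReal.ofReal (-h x) ∂μ := by
    refine lintegral_congr_ae ?_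
    filter_upwards [hfh] with x hx
    rw [hx, ← EReal.coe_neg, EReal.real_coe_toENNReal]
  have f1 : ∫⁻ x, ENNReal.ofReal (h x) ∂μ ≠ ⊤ := hh.lintegral_lt_top.ne
  have f2 : ∫⁻ x, ENNReal.ofReal (-h x) ∂μ ≠ ⊤ := hh.neg.lintegral_lt_top.ne
  rw [extIntegral, h1, h2, integral_eq_lintegral_pos_part_sub_lintegral_neg_part hh,
    EReal.coe_sub, EReal.coe_ennreal_toReal f1, EReal.coe_ennreal_toReal f2]

/-! ### The convex conjugate -/

theorem inner_sub_le_leg {n : ℕ} (ψ : EucSp n → EReal) (x y : EucSp n) :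
    ((inner ℝ x y : ℝ) : EReal) - ψ y ≤ leg ψ x :=
  le_iSup (fun y : EucSp n => ((inner ℝ x y : ℝ) : EReal) - ψ y) y

theorem leg_ne_bot {n : ℕ} {ψ : EucSp n → EReal} (hψ : ∃ y, ψ y < ⊤) (x : EucSp n) :
    leg ψ x ≠ ⊥ := by
  obtain ⟨y, hy⟩ := hψ
  refine ne_bot_of_le_ne_bot ?_ (inner_sub_le_leg ψ x y)
  rw [sub_eq_add_neg, Ne, EReal.add_eq_bot_iff, EReal.neg_eq_bot_iff]
  exact not_or.2 ⟨EReal.coe_ne_bot _, hy.ne⟩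

theorem leg_combo_le {n : ℕ} (ψ : EucSp n → EReal) {x y : EucSp n} {a b c d : ℝ} (ha : 0 ≤ a)
    (hb : 0 ≤ b) (hab : a + b = 1) (hx : leg ψ x ≤ (c : EReal)) (hy : leg ψ y ≤ (d : EReal)) :
    leg ψ (a • x + b • y) ≤ ((a * c + b * d : ℝ) : EReal) := by
  refine iSup_le fun w => ?_
  have h1 := (inner_sub_le_leg ψ x w).trans hx
  have h2 := (inner_sub_le_leg ψ y w).trans hy
  induction hw : ψ w using EReal.rec with
  | bot => simp [hw] at h1
  | top => simp
  | coe s =>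
    rw [hw, ← EReal.coe_sub, EReal.coe_le_coe_iff] at h1 h2
    rw [← EReal.coe_sub, EReal.coe_le_coe_iff, inner_add_left, real_inner_smul_left,
      real_inner_smul_left]
    have hs : s = a * s + b * s := by rw [← add_mul, hab, one_mul]
    nlinarith [mul_le_mul_of_nonneg_left h1 ha, mul_le_mul_of_nonneg_left h2 hb]

/-- Convexity along a segment, solved for the far endpoint `y`. In this form it remains meaningful
when `leg ψ y = ⊤`, and it can be integrated over rotations. -/
theorem coe_div_le_leg {n : ℕ} {ψ : EucSp n → EReal} (hψ : ∃ y, ψ y < ⊤) {x y : EucSp n}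
    {t c d : ℝ} (ht : 0 < t) (ht1 : t ≤ 1) (hx : leg ψ x = (c : EReal))
    (hz : leg ψ ((1 - t) • x + t • y) = (d : EReal)) :
    (((d - (1 - t) * c) / t : ℝ) : EReal) ≤ leg ψ y := by
  induction hy : leg ψ y using EReal.rec with
  | bot => exact absurd hy (leg_ne_bot hψ y)
  | top => exact le_top
  | coe e =>
    have := leg_combo_le ψ (sub_nonneg.2 ht1) ht.le (by ring) hx.le hy.le
    rw [hz, EReal.coe_le_coe_iff] at this
    rw [EReal.coe_le_coe_iff, div_le_iff₀ ht]
    linarith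

/-- A finite convex function is continuous on the open `R`-ball; its restriction to the compact
`ρ`-ball is bounded and extends by Tietze. -/
theorem exists_boundedContinuous_eq_leg {n : ℕ} {ψ : EucSp n → EReal} (hψ : ∃ y, ψ y < ⊤)
    {ρ R : ℝ} (hρ : ρ < R) (hR : Metric.closedBall (0 : EucSp n) R ⊆ effDom (leg ψ)) :
    ∃ H : BoundedContinuousFunction (EucSp n) ℝ,
      ∀ x ∈ Metric.closedBall (0 : EucSp n) ρ, leg ψ x = (H x : EReal) := by
  have hcoe : ∀ x ∈ Metric.closedBall (0 : EucSp n) R, leg ψ x = ((leg ψ x).toReal : EReal) :=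
    fun x hx => (EReal.coe_toReal (hR hx).ne (leg_ne_bot hψ x)).symm
  have hconv : ConvexOn ℝ (Metric.ball (0 : EucSp n) R) fun x => (leg ψ x).toReal := by
    refine ⟨convex_ball _ _, fun x hx y hy a b ha hb hab => ?_⟩
    have hz := (convex_ball (0 : EucSp n) R) hx hy ha hb hab
    have := leg_combo_le ψ ha hb hab (hcoe x (Metric.ball_subset_closedBall hx)).le
      (hcoe y (Metric.ball_subset_closedBall hy)).le
    rw [hcoe _ (Metric.ball_subset_closedBall hz), EReal.coe_le_coe_iff] at this
    exact this
  have hcont : ContinuousOn (fun x => (leg ψ x).toReal) (Metric.closedBall (0 : EucSp n) ρ) :=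
    (hconv.continuousOn Metric.isOpen_ball).mono (Metric.closedBall_subset_ball hρ)
  have : CompactSpace (Metric.closedBall (0 : EucSp n) ρ) :=
    isCompact_iff_compactSpace.1 (isCompact_closedBall _ _)
  obtain ⟨F, hF⟩ : ∃ F : BoundedContinuousFunction (Metric.closedBall (0 : EucSp n) ρ) ℝ,
      ∀ x, F x = (leg ψ x).toReal :=
    ⟨BoundedContinuousFunction.mkOfCompact
      ⟨_, continuousOn_iff_continuous_domRestrict.1 hcont⟩, fun x => rfl⟩
  obtain ⟨H, -, hH⟩ := F.exists_norm_eq_domRestrict_eq_of_closed Metric.isClosed_closedBall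
  refine ⟨H, fun x hx => ?_⟩
  rw [hcoe x (Metric.closedBall_subset_closedBall hρ.le hx), ← hF ⟨x, hx⟩, ← hH]
  rfl

/-! ### Subgradients and biconjugation. -/

theorem ConvexOn.exists_subgradient {E : Type*} [NormedAddCommGroup E] [InnerProductSpace ℝ E]
    [FiniteDimensional ℝ E] {U : Set E} {h : E → ℝ} (hU : IsOpen U)
    (hh : ConvexOn ℝ U h) {x : E} (hx : x ∈ U) :
    ∃ p : E, ∀ z ∈ U, h x + inner ℝ p (z - x) ≤ h z := by
  have hop : IsOpen {q : E × ℝ | q.1 ∈ U ∧ h q.1 < q.2} := by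
    have hc : ContinuousOn (fun q : E × ℝ => q.2 - h q.1) (Prod.fst ⁻¹' U) :=
      continuousOn_snd.sub ((hh.continuousOn hU).comp continuousOn_fst fun q hq => hq)
    convert hc.isOpen_inter_preimage (hU.preimage continuous_fst) (isOpen_Ioi (a := (0 : ℝ)))
      using 1
    ext q
    simp
  -- Separate the graph point from the open strict epigraph. Comparison with the point one unit
  -- higher makes the vertical coefficient of `f` positive; dividing by it gives the slope.
  obtain ⟨f, hf⟩ := geometric_hahn_banach_point_open hh.convex_strict_epigraph hop
    (x := (x, h x)) (by simp)
  have hsplit : ∀ z s, f (z, s) = f (z, 0) + s * f (0, 1) := fun z s => by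
    have : ((z, s) : E × ℝ) = (z, 0) + s • (0, 1) := by simp
    rw [this, map_add, map_smul, smul_eq_mul]
  have hpos : 0 < f (0, 1) := by
    have := hf (x, h x + 1) ⟨hx, by simp⟩
    rw [hsplit x (h x), hsplit x (h x + 1)] at this
    linarith
  let φ : StrongDual ℝ E := f.comp (ContinuousLinearMap.inl ℝ E ℝ)
  refine ⟨-((f (0, 1))⁻¹ • (InnerProductSpace.toDual ℝ E).symm φ), fun z hz => ?_⟩
  rw [inner_neg_left, real_inner_smul_left, InnerProductSpace.toDual_symm_apply]
  -- The strict epigraph omits `(z, h z)`, so it is approached from above.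
  refine le_of_forall_pos_le_add fun ε hε => ?_
  have h1 := hf (z, h z + ε) ⟨hz, by simpa using hε⟩
  rw [hsplit x, hsplit z] at h1
  have h2 : φ (z - x) = f (z, 0) - f (x, 0) := by rw [map_sub]; rfl
  rw [h2]
  have h3 : (f (0, 1))⁻¹ * (f (z, 0) - f (x, 0)) > h x - (h z + ε) := by
    rw [gt_iff_lt, inv_mul_eq_div, lt_div_iff₀ hpos]
    linarith
  linarith

theorem leg_leg_le {n : ℕ} {m : EucSp n → EReal} {x : EucSp n} {c : ℝ} (hx : m x = (c : EReal)) :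
    leg (leg m) x ≤ (c : EReal) := by
  refine iSup_le fun p => ?_
  have h1 := inner_sub_le_leg m p x
  rw [hx, ← EReal.coe_sub] at h1
  refine (EReal.sub_le_sub le_rfl h1).trans ?_
  rw [← EReal.coe_sub, EReal.coe_le_coe_iff, real_inner_comm]
  linarith

/-- A subgradient of `h` at `x` gives an affine minorant of `m` on all of space, exact at `x`, and
this forces the biconjugate up to `h x`. `hsegm` stands in for convexity of `m` outside `U`, where
`m` may be infinite. -/
theorem leg_leg_eq {n : ℕ} {m : EucSp n → EReal} {U : Set (EucSp n)} {h : EucSp n → ℝ}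
    (hU : IsOpen U) (hmh : ∀ x ∈ U, m x = (h x : EReal)) (hconv : ConvexOn ℝ U h)
    (hsegm : ∀ x ∈ U, ∀ y : EucSp n, ∀ t : ℝ, 0 < t → t ≤ 1 → (1 - t) • x + t • y ∈ U →
      (((h ((1 - t) • x + t • y) - (1 - t) * h x) / t : ℝ) : EReal) ≤ m y)
    {x : EucSp n} (hx : x ∈ U) : leg (leg m) x = (h x : EReal) := by
  refine le_antisymm (leg_leg_le (hmh x hx)) ?_
  obtain ⟨p, hp⟩ := hconv.exists_subgradient hU hx
  have hglob : ∀ y, ((h x + inner ℝ p (y - x) : ℝ) : EReal) ≤ m y := by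
    intro y
    have hcont : Tendsto (fun t : ℝ => (1 - t) • x + t • y) (𝓝[>] 0) (𝓝 x) := by
      have : Continuous fun t : ℝ => (1 - t) • x + t • y := by fun_prop
      simpa using (this.tendsto 0).mono_left nhdsWithin_le_nhds
    -- A short step from `x` towards `y` stays in `U`, where the subgradient inequality is
    -- available.
    obtain ⟨t, htU, ht0, ht1⟩ := ((hcont.eventually (hU.mem_nhds hx)).and
      (Ioc_mem_nhdsGT (zero_lt_one (α := ℝ)))).exists
    refine le_trans ?_ (hsegm x hx y t ht0 ht1 htU)
    have h1 := hp _ htU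
    have h2 : (1 - t) • x + t • y - x = t • (y - x) := by module
    rw [h2, real_inner_smul_right] at h1
    rw [EReal.coe_le_coe_iff, le_div_iff₀ ht0]
    linarith
  have hlp : leg m p ≤ ((inner ℝ p x - h x : ℝ) : EReal) := by
    refine iSup_le fun y => (EReal.sub_le_sub le_rfl (hglob y)).trans ?_
    rw [← EReal.coe_sub, EReal.coe_le_coe_iff, inner_sub_right]
    linarith
  refine le_trans ?_ ((EReal.sub_le_sub le_rfl hlp).trans (inner_sub_le_leg (leg m) x p))
  rw [← EReal.coe_sub, EReal.coe_le_coe_iff, real_inner_comm]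
  linarith

/-! ### Rotations -/

theorem inv_eq_transpose_of_mem_OGrp {n : ℕ} {A : Matrix (Fin n) (Fin n) ℝ} (hA : A ∈ OGrp n) :
    A⁻¹ = A.transpose :=
  Matrix.inv_eq_right_inv ((Matrix.mem_orthogonalGroup_iff _ _).1 hA)

theorem inner_toEuclideanLin_transpose {n : ℕ} (A : Matrix (Fin n) (Fin n) ℝ) (x y : EucSp n) :
    inner ℝ (Matrix.toEuclideanLin A.transpose x) y =
      inner ℝ x (Matrix.toEuclideanLin A y) := by
  have h := Matrix.toEuclideanLin_conjTranspose_eq_adjoint A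
  rw [Matrix.conjTranspose_eq_transpose_of_trivial] at h
  rw [h, LinearMap.adjoint_inner_left]

theorem toEuclideanLin_mul_apply {n : ℕ} (A B : Matrix (Fin n) (Fin n) ℝ) (x : EucSp n) :
    Matrix.toEuclideanLin A (Matrix.toEuclideanLin B x) = Matrix.toEuclideanLin (A * B) x := by
  simp [Matrix.toLpLin_apply]

theorem norm_toEuclideanLin_transpose {n : ℕ} {A : Matrix (Fin n) (Fin n) ℝ} (hA : A ∈ OGrp n)
    (x : EucSp n) : ‖Matrix.toEuclideanLin A.transpose x‖ = ‖x‖ := by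
  have h : ‖Matrix.toEuclideanLin A.transpose x‖ ^ 2 = ‖x‖ ^ 2 := by
    rw [← real_inner_self_eq_norm_sq, inner_toEuclideanLin_transpose, toEuclideanLin_mul_apply,
      (Matrix.mem_orthogonalGroup_iff _ _).1 hA, ← real_inner_self_eq_norm_sq]
    simp
  exact (sq_eq_sq₀ (norm_nonneg _) (norm_nonneg _)).1 h

theorem continuous_toEuclideanLin_transpose (n : ℕ) :
    Continuous fun q : Matrix (Fin n) (Fin n) ℝ × EucSp n =>
      Matrix.toEuclideanLin q.1.transpose q.2 := by
  simp only [Matrix.toLpLin_apply]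
  refine (PiLp.continuous_toLp 2 _).comp ?_
  exact continuous_fst.matrix_transpose.matrix_mulVec
    ((PiLp.continuous_ofLp 2 _).comp continuous_snd)

/-- Substitute `y ↦ A y` in the supremum; `Aᵀ` is both adjoint and inverse of `A`. -/
theorem leg_compInv {n : ℕ} (ψ : EucSp n → EReal) {A : Matrix (Fin n) (Fin n) ℝ}
    (hA : A ∈ OGrp n) (x : EucSp n) :
    leg (compInv ψ A) x = leg ψ (Matrix.toEuclideanLin A.transpose x) := by
  have hA' : A * A.transpose = 1 := (Matrix.mem_orthogonalGroup_iff _ _).1 hA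
  have hA'' : A.transpose * A = 1 := (Matrix.mem_orthogonalGroup_iff' _ _).1 hA
  refine le_antisymm (iSup_le fun y => ?_) (iSup_le fun y => ?_)
  · refine le_trans (le_of_eq ?_) (inner_sub_le_leg ψ _ (Matrix.toEuclideanLin A.transpose y))
    rw [inner_toEuclideanLin_transpose, toEuclideanLin_mul_apply, hA', compInv,
      inv_eq_transpose_of_mem_OGrp hA]
    simp
  · refine le_trans (le_of_eq ?_) (inner_sub_le_leg (compInv ψ A) x (Matrix.toEuclideanLin A y))
    rw [inner_toEuclideanLin_transpose, compInv, inv_eq_transpose_of_mem_OGrp hA,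
      toEuclideanLin_mul_apply, hA'']
    simp

theorem SOGrp_le_OGrp {n : ℕ} {A : Matrix (Fin n) (Fin n) ℝ} (hA : A ∈ SOGrp n) : A ∈ OGrp n :=
  (Matrix.mem_specialOrthogonalGroup_iff.1 hA).1

/-! ### The average functional under rotations -/

section Average

variable {n : ℕ} {ψ : EucSp n → EReal} {ρ : ℝ} {H : BoundedContinuousFunction (EucSp n) ℝ}

theorem leg_toEuclideanLin_eq
    (hH : ∀ x ∈ Metric.closedBall (0 : EucSp n) ρ, leg ψ x = (H x : EReal))
    {A : Matrix (Fin n) (Fin n) ℝ} (hA : A ∈ OGrp n) {x : EucSp n}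
    (hx : x ∈ Metric.closedBall (0 : EucSp n) ρ) :
    leg ψ (Matrix.toEuclideanLin A.transpose x) =
      (H (Matrix.toEuclideanLin A.transpose x) : EReal) := by
  refine hH _ ?_
  rw [mem_closedBall_zero_iff, norm_toEuclideanLin_transpose hA]
  exact mem_closedBall_zero_iff.1 hx

theorem continuous_rotated (H : BoundedContinuousFunction (EucSp n) ℝ) :
    Continuous fun q : Matrix (Fin n) (Fin n) ℝ × EucSp n =>
      H (Matrix.toEuclideanLin q.1.transpose q.2) :=
  H.continuous.comp (continuous_toEuclideanLin_transpose n)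

theorem integrable_rotated (H : BoundedContinuousFunction (EucSp n) ℝ) (μ : Measure (EucSp n))
    [IsProbabilityMeasure μ] (A : Matrix (Fin n) (Fin n) ℝ) :
    Integrable (fun x => H (Matrix.toEuclideanLin A.transpose x)) μ :=
  Integrable.of_bound ((continuous_rotated H).comp (Continuous.prodMk_right A)).aestronglyMeasurable
    ‖H‖ (Eventually.of_forall fun _ => H.norm_coe_le_norm _)

theorem integrable_rotated_haar (H : BoundedContinuousFunction (EucSp n) ℝ) (x : EucSp n) :
    Integrable (fun A : SOGrp n =>
      H (Matrix.toEuclideanLin (A : Matrix (Fin n) (Fin n) ℝ).transpose x)) (haarSO n) :=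
  Integrable.of_bound (((continuous_rotated H).comp
    (Continuous.prodMk_left x)).comp continuous_subtype_val).aestronglyMeasurable
    ‖H‖ (Eventually.of_forall fun _ => H.norm_coe_le_norm _)

/-- Dominated convergence with the constant bound `‖H‖`. -/
theorem continuous_integral_rotated (H : BoundedContinuousFunction (EucSp n) ℝ)
    (μ : Measure (EucSp n)) [IsProbabilityMeasure μ] :
    Continuous fun A : Matrix (Fin n) (Fin n) ℝ =>
      ∫ x, H (Matrix.toEuclideanLin A.transpose x) ∂μ := by
  have : FirstCountableTopology (Matrix (Fin n) (Fin n) ℝ) :=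
    inferInstanceAs (FirstCountableTopology (Fin n → Fin n → ℝ))
  refine continuous_of_dominated (bound := fun _ => ‖H‖)
    (fun A => (integrable_rotated H μ A).aestronglyMeasurable)
    (fun A => Eventually.of_forall fun x => ?_) (integrable_const ‖H‖)
    (Eventually.of_forall fun x => ?_)
  · exact H.norm_coe_le_norm _
  · have h := (continuous_rotated H).comp (Continuous.prodMk_left x)
    exact h

theorem PhiAvg_compInv
    (hH : ∀ x ∈ Metric.closedBall (0 : EucSp n) ρ, leg ψ x = (H x : EReal))
    {μ : Measure (EucSp n)} [IsProbabilityMeasure μ]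
    (hμ : ∀ᵐ x ∂μ, x ∈ Metric.closedBall (0 : EucSp n) ρ)
    {A : Matrix (Fin n) (Fin n) ℝ} (hA : A ∈ OGrp n) :
    PhiAvg (compInv ψ A) μ =
      ((∫ x, H (Matrix.toEuclideanLin A.transpose x) ∂μ : ℝ) : EReal) := by
  refine extIntegral_eq_coe_integral (integrable_rotated H μ A) ?_
  filter_upwards [hμ] with x hx
  rw [leg_compInv ψ hA, leg_toEuclideanLin_eq hH hA hx]

/-! ### The rotational mean of the conjugate -/

theorem legRotMean_eq_extIntegral (ψ : EucSp n → EReal) (x : EucSp n) :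
    legRotMean ψ x = extIntegral (haarSO n) fun A : SOGrp n =>
      leg ψ (Matrix.toEuclideanLin (A : Matrix (Fin n) (Fin n) ℝ).transpose x) := by
  have h : ∀ A : SOGrp n, compInv (leg ψ) (A : Matrix (Fin n) (Fin n) ℝ) x =
      leg ψ (Matrix.toEuclideanLin (A : Matrix (Fin n) (Fin n) ℝ).transpose x) := fun A => by
    rw [compInv, inv_eq_transpose_of_mem_OGrp (SOGrp_le_OGrp A.2)]
  simp only [legRotMean, h]

theorem legRotMean_eq
    (hH : ∀ x ∈ Metric.closedBall (0 : EucSp n) ρ, leg ψ x = (H x : EReal))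
    {x : EucSp n} (hx : x ∈ Metric.closedBall (0 : EucSp n) ρ) :
    legRotMean ψ x = ((∫ A : SOGrp n,
      H (Matrix.toEuclideanLin (A : Matrix (Fin n) (Fin n) ℝ).transpose x) ∂haarSO n : ℝ) :
        EReal) := by
  rw [legRotMean_eq_extIntegral]
  exact extIntegral_eq_coe_integral (integrable_rotated_haar H x)
    (Eventually.of_forall fun A => leg_toEuclideanLin_eq hH (SOGrp_le_OGrp A.2) hx)

theorem leg_leg_legRotMean (hψ : ∃ y, ψ y < ⊤)
    (hH : ∀ x ∈ Metric.closedBall (0 : EucSp n) ρ, leg ψ x = (H x : EReal))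
    {x : EucSp n} (hx : x ∈ Metric.ball (0 : EucSp n) ρ) :
    leg (leg (legRotMean ψ)) x = ((∫ A : SOGrp n,
      H (Matrix.toEuclideanLin (A : Matrix (Fin n) (Fin n) ℝ).transpose x) ∂haarSO n : ℝ) :
        EReal) := by
  refine leg_leg_eq (h := fun x => ∫ A : SOGrp n,
      H (Matrix.toEuclideanLin (A : Matrix (Fin n) (Fin n) ℝ).transpose x) ∂haarSO n)
    Metric.isOpen_ball (fun x hx => legRotMean_eq hH (Metric.ball_subset_closedBall hx))
    ⟨convex_ball _ _, ?_⟩ ?_ hx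
  · intro x hx y hy a b ha hb hab
    have hz := Metric.ball_subset_closedBall ((convex_ball (0 : EucSp n) ρ) hx hy ha hb hab)
    have hi := integrable_rotated_haar H x
    have hj := integrable_rotated_haar H y
    simp only [smul_eq_mul]
    rw [← integral_const_mul, ← integral_const_mul,
      ← integral_add (hi.const_mul a) (hj.const_mul b)]
    refine integral_mono (integrable_rotated_haar H _) ((hi.const_mul a).add (hj.const_mul b))
      fun A => ?_
    have hA := SOGrp_le_OGrp A.2
    have := leg_combo_le ψ ha hb hab
      (leg_toEuclideanLin_eq hH hA (Metric.ball_subset_closedBall hx)).le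
      (leg_toEuclideanLin_eq hH hA (Metric.ball_subset_closedBall hy)).le
    rw [← map_smul, ← map_smul, ← map_add, leg_toEuclideanLin_eq hH hA hz,
      EReal.coe_le_coe_iff] at this
    exact this
  · intro x hx y t ht ht1 hz
    have hi := integrable_rotated_haar H x
    have hk := integrable_rotated_haar H ((1 - t) • x + t • y)
    rw [← integral_const_mul, ← integral_sub hk (hi.const_mul _), ← integral_div,
      legRotMean_eq_extIntegral]
    -- `y` is arbitrary here, so the integrand on the right may take the value `⊤`;
    -- `extIntegral_mono` compares the integrals without any measurability.
    refine (extIntegral_eq_coe_integral ((hk.sub (hi.const_mul (1 - t))).div_const t)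
        (Eventually.of_forall fun A => rfl)).symm.le.trans (extIntegral_mono _ fun A => ?_)
    have hA := SOGrp_le_OGrp A.2
    refine coe_div_le_leg hψ ht ht1
      (leg_toEuclideanLin_eq hH hA (Metric.ball_subset_closedBall hx)) ?_
    rw [← map_smul, ← map_smul, ← map_add]
    exact leg_toEuclideanLin_eq hH hA (Metric.ball_subset_closedBall hz)

/-- Biconjugation recovers the mean only in the interior, hence the open ball in `hμ`; the rest is
Fubini for the bounded continuous integrand. -/
theorem PhiAvg_leg_legRotMean (hψ : ∃ y, ψ y < ⊤)
    (hH : ∀ x ∈ Metric.closedBall (0 : EucSp n) ρ, leg ψ x = (H x : EReal))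
    {μ : Measure (EucSp n)} [IsProbabilityMeasure μ]
    (hμ : ∀ᵐ x ∂μ, x ∈ Metric.ball (0 : EucSp n) ρ) :
    PhiAvg (leg (legRotMean ψ)) μ = ((∫ A : SOGrp n, ∫ x,
      H (Matrix.toEuclideanLin (A : Matrix (Fin n) (Fin n) ℝ).transpose x) ∂μ ∂haarSO n : ℝ) :
        EReal) := by
  have : SecondCountableTopology (Matrix (Fin n) (Fin n) ℝ) :=
    inferInstanceAs (SecondCountableTopology (Fin n → Fin n → ℝ))
  have hint : Integrable (Function.uncurry fun (A : SOGrp n) (x : EucSp n) =>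
      H (Matrix.toEuclideanLin (A : Matrix (Fin n) (Fin n) ℝ).transpose x))
      ((haarSO n).prod μ) :=
    Integrable.of_bound ((continuous_rotated H).comp (f := fun q : SOGrp n × EucSp n =>
        ((q.1 : Matrix (Fin n) (Fin n) ℝ), q.2)) (by fun_prop)).aestronglyMeasurable ‖H‖
      (Eventually.of_forall fun q => H.norm_coe_le_norm _)
  rw [integral_integral_swap hint]
  refine extIntegral_eq_coe_integral hint.swap.integral_prod_left ?_
  filter_upwards [hμ] with x hx
  exact leg_leg_legRotMean hψ hH hx

end Average

/-! ### Dimension one -/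

theorem coe_inner_sub_le {n : ℕ} {ψ : EucSp n → EReal} {x : EucSp n} {c : ℝ}
    (hx : leg ψ x = (c : EReal)) (y : EucSp n) : ((inner ℝ x y - c : ℝ) : EReal) ≤ ψ y := by
  have h := (inner_sub_le_leg ψ x y).trans hx.le
  induction hy : ψ y using EReal.rec with
  | bot => simp [hy] at h
  | top => exact le_top
  | coe s =>
    rw [hy, ← EReal.coe_sub, EReal.coe_le_coe_iff] at h
    rw [EReal.coe_le_coe_iff]
    linarith

theorem exists_lt_inner_sub {n : ℕ} {ψ : EucSp n → EReal} (hbot : ∀ y, ψ y ≠ ⊥) {x : EucSp n}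
    {c e : ℝ} (hx : leg ψ x = (c : EReal)) (he : e < c) :
    ∃ (y : EucSp n) (s : ℝ), ψ y = (s : EReal) ∧ e < inner ℝ x y - s := by
  have h : (e : EReal) < leg ψ x := by rw [hx]; exact_mod_cast he
  obtain ⟨y, hy⟩ := lt_iSup_iff.1 h
  induction hs : ψ y using EReal.rec with
  | bot => exact absurd hs (hbot y)
  | top => simp [hs] at hy
  | coe s =>
    rw [hs, ← EReal.coe_sub, EReal.coe_lt_coe_iff] at hy
    exact ⟨y, s, hs, hy⟩

/-- Conjugation turns infimal convolution into a sum and epi-multiplication into multiplication. -/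
theorem leg_epiMul_infConv {n : ℕ} {ψ : EucSp n → EReal} (hbot : ∀ y, ψ y ≠ ⊥)
    {x : EucSp n} {c d : ℝ} (hx : leg ψ x = (c : EReal)) (hx' : leg ψ (-x) = (d : EReal)) :
    leg (epiMul (1 / 2) (infConv ψ fun x => ψ (-x))) x = (((c + d) / 2 : ℝ) : EReal) := by
  have hhalf : (0 : EReal) ≤ ((1 / 2 : ℝ) : EReal) := by exact_mod_cast (by norm_num : (0:ℝ) ≤ 1 / 2)
  refine le_antisymm (iSup_le fun w => ?_) (le_of_forall_lt_imp_le_of_dense fun a ha => ?_)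
  · have h1 : ((2 * inner ℝ x w - c - d : ℝ) : EReal) ≤
        infConv ψ (fun x => ψ (-x)) ((1 / 2 : ℝ)⁻¹ • w) := by
      refine le_iInf fun y => ?_
      refine le_trans (le_of_eq ?_)
        (add_le_add (coe_inner_sub_le hx _) (coe_inner_sub_le hx' (-y)))
      rw [← EReal.coe_add, inner_sub_right, inner_neg_neg, real_inner_smul_right]
      congr 1
      norm_num
      ring
    have h2 := mul_le_mul_of_nonneg_left h1 hhalf
    refine (EReal.sub_le_sub le_rfl h2).trans ?_
    rw [← EReal.coe_mul, ← EReal.coe_sub, EReal.coe_le_coe_iff]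
    linarith
  · obtain ⟨e, hae, he⟩ := EReal.lt_iff_exists_real_btwn.1 ha
    refine hae.le.trans ?_
    rw [EReal.coe_lt_coe_iff] at he
    -- Near-maximisers `y` for `x` and `z` for `-x`, each with slack `(c + d) / 2 - e`, average to a
    -- value above `e` at the point `(y - z) / 2`.
    obtain ⟨y, s, hys, hy⟩ := exists_lt_inner_sub hbot hx (e := c - ((c + d) / 2 - e)) (by linarith)
    obtain ⟨z, r, hzr, hz⟩ := exists_lt_inner_sub hbot hx' (e := d - ((c + d) / 2 - e)) (by linarith)
    have h1 : infConv ψ (fun x => ψ (-x)) ((1 / 2 : ℝ)⁻¹ • ((1 / 2 : ℝ) • (y - z))) ≤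
        ((s + r : ℝ) : EReal) := by
      refine (iInf_le _ (-z)).trans (le_of_eq ?_)
      rw [inv_smul_smul₀ (by norm_num), sub_neg_eq_add, sub_add_cancel, hys, EReal.coe_add]
      simp only [neg_neg, hzr]
    have h2 := mul_le_mul_of_nonneg_left h1 hhalf
    refine le_trans ?_ ((EReal.sub_le_sub le_rfl h2).trans
      (inner_sub_le_leg (epiMul (1 / 2) (infConv ψ fun x => ψ (-x))) x ((1 / 2 : ℝ) • (y - z))))
    rw [← EReal.coe_mul, ← EReal.coe_sub, EReal.coe_le_coe_iff, real_inner_smul_right,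
      inner_sub_right]
    rw [inner_neg_left] at hz
    linarith

theorem mem_OGrp_one {A : Matrix (Fin 1) (Fin 1) ℝ} (hA : A ∈ OGrp 1) : A = 1 ∨ A = -1 := by
  have h := congrFun (congrFun ((Matrix.mem_orthogonalGroup_iff _ _).1 hA) 0) 0
  simp only [Matrix.mul_apply, Fin.sum_univ_one, Matrix.transpose_apply, Matrix.one_apply_eq] at h
  rcases mul_self_eq_one_iff.1 h with h | h
  · left; ext i j; rw [Subsingleton.elim i 0, Subsingleton.elim j 0]; simpa using h
  · right; ext i j; rw [Subsingleton.elim i 0, Subsingleton.elim j 0]; simpa using h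

/-! ### Choice of radii and the main theorem. -/

theorem exists_radius {n : ℕ} {μ : Measure (EucSp n)} [IsProbabilityMeasure μ]
    {ψ : EucSp n → EReal} (hr : suppRadius μ < slopeRadius ψ) :
    ∃ ρ R : ℝ, ρ < R ∧ (∀ᵐ x ∂μ, x ∈ Metric.ball (0 : EucSp n) ρ) ∧
      Metric.closedBall (0 : EucSp n) R ⊆ effDom (leg ψ) := by
  obtain ⟨⟨R, hR⟩, hlt⟩ := lt_iSup_iff.1 hr
  -- Strictness on both sides of `ρ` puts the support in the open ball and leaves room below `R` for
  -- continuity.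
  obtain ⟨ρ, h1, h2⟩ := ENNReal.lt_iff_exists_nnreal_btwn.1 hlt
  refine ⟨ρ, R, by exact_mod_cast h2, ?_, hR⟩
  filter_upwards [Measure.support_mem_ae (μ := μ)] with x hx
  have : ‖x‖ₑ < ρ := (le_iSup₂ (f := fun y (_ : y ∈ μ.support) => ‖y‖ₑ) x hx).trans_lt h1
  rw [mem_ball_zero_iff]
  rw [enorm_eq_nnnorm, ENNReal.coe_lt_coe] at this
  exact_mod_cast this

theorem mainTheorem9 (n : ℕ) (μ : Measure (EucSp n)) [IsProbabilityMeasure μ]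
    (hμ : IsCompact μ.support) (ψ : EucSp n → EReal) (hψ : IsConvC ψ)
    (hr : suppRadius μ < slopeRadius ψ) :
    (2 ≤ n →
      (∀ A ∈ SOGrp n, PhiAvg (compInv ψ A) μ ≠ ⊥ ∧ PhiAvg (compInv ψ A) μ ≠ ⊤) ∧
      (PhiAvg (psiRot ψ) μ ≠ ⊥ ∧ PhiAvg (psiRot ψ) μ ≠ ⊤) ∧
      ∃ A₀ ∈ SOGrp n,
        (∀ A ∈ SOGrp n, PhiAvg (compInv ψ A₀) μ ≤ PhiAvg (compInv ψ A) μ) ∧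
        PhiAvg (compInv ψ A₀) μ ≤ PhiAvg (psiRot ψ) μ) ∧
    (n = 1 →
      (∀ A ∈ OGrp n, PhiAvg (compInv ψ A) μ ≠ ⊥ ∧ PhiAvg (compInv ψ A) μ ≠ ⊤) ∧
      (PhiAvg (psiRot ψ) μ ≠ ⊥ ∧ PhiAvg (psiRot ψ) μ ≠ ⊤) ∧
      ∃ A₀ ∈ OGrp n,
        (∀ A ∈ OGrp n, PhiAvg (compInv ψ A₀) μ ≤ PhiAvg (compInv ψ A) μ) ∧
        PhiAvg (compInv ψ A₀) μ ≤ PhiAvg (psiRot ψ) μ) := by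
  obtain ⟨ρ, R, hρR, hball, hR⟩ := exists_radius hr
  obtain ⟨H, hH⟩ := exists_boundedContinuous_eq_leg hψ.proper hρR hR
  have hcball : ∀ᵐ x ∂μ, x ∈ Metric.closedBall (0 : EucSp n) ρ :=
    hball.mono fun x hx => Metric.ball_subset_closedBall hx
  have hPhi := fun (A : Matrix (Fin n) (Fin n) ℝ) (hA : A ∈ OGrp n) =>
    PhiAvg_compInv hH hcball hA
  have hfin : ∀ A ∈ OGrp n, PhiAvg (compInv ψ A) μ ≠ ⊥ ∧ PhiAvg (compInv ψ A) μ ≠ ⊤ :=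
    fun A hA => by
      rw [hPhi A hA]
      exact ⟨EReal.coe_ne_bot _, EReal.coe_ne_top _⟩
  refine ⟨fun hn => ?_, fun hn => ?_⟩
  · have hrot : PhiAvg (psiRot ψ) μ = ((∫ A : SOGrp n, ∫ x,
        H (Matrix.toEuclideanLin (A : Matrix (Fin n) (Fin n) ℝ).transpose x) ∂μ ∂haarSO n : ℝ) :
          EReal) := by
      rw [psiRot, if_neg (by omega)]
      exact PhiAvg_leg_legRotMean hψ.proper hH hball
    have hcont := continuous_integral_rotated H μ
    obtain ⟨A₀, hA₀, hmin⟩ := (isCompact_SOGrp n).exists_isMinOn ⟨1, one_mem (SOGrp n)⟩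
      hcont.continuousOn
    refine ⟨fun A hA => hfin A (SOGrp_le_OGrp hA), ?_, A₀, hA₀, fun A hA => ?_, ?_⟩
    · rw [hrot]
      exact ⟨EReal.coe_ne_bot _, EReal.coe_ne_top _⟩
    · rw [hPhi _ (SOGrp_le_OGrp hA₀), hPhi _ (SOGrp_le_OGrp hA), EReal.coe_le_coe_iff]
      exact hmin hA
    · rw [hPhi _ (SOGrp_le_OGrp hA₀), hrot, EReal.coe_le_coe_iff]
      have hint : Integrable (fun A : SOGrp n => ∫ x,
          H (Matrix.toEuclideanLin (A : Matrix (Fin n) (Fin n) ℝ).transpose x) ∂μ) (haarSO n) :=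
        (hcont.comp continuous_subtype_val).integrable_of_hasCompactSupport
          (HasCompactSupport.of_compactSpace _)
      -- The minimum is at most the mean, as Haar measure has total mass one.
      have := integral_mono (integrable_const _) hint fun A => hmin A.2
      simpa using this
  · subst hn
    have h1 : (1 : Matrix (Fin 1) (Fin 1) ℝ) ∈ OGrp 1 := one_mem _
    have h2 : (-1 : Matrix (Fin 1) (Fin 1) ℝ) ∈ OGrp 1 := by
      rw [Matrix.mem_orthogonalGroup_iff]
      simp
    have hi1 := integrable_rotated H μ 1
    have hi2 := integrable_rotated H μ (-1)
    have hrot : PhiAvg (psiRot ψ) μ =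
        (((∫ x, H (Matrix.toEuclideanLin (1 : Matrix (Fin 1) (Fin 1) ℝ).transpose x) ∂μ +
          ∫ x, H (Matrix.toEuclideanLin (-1 : Matrix (Fin 1) (Fin 1) ℝ).transpose x) ∂μ) / 2 : ℝ) :
            EReal) := by
      rw [psiRot, if_pos rfl, ← integral_add hi1 hi2, ← integral_div]
      refine extIntegral_eq_coe_integral ((hi1.add hi2).div_const 2) ?_
      filter_upwards [hcball] with x hx
      refine leg_epiMul_infConv hψ.ne_bot ?_ ?_
      · simpa using leg_toEuclideanLin_eq hH h1 hx
      · simpa using leg_toEuclideanLin_eq hH h2 hx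
    refine ⟨hfin, ?_, ?_⟩
    · rw [hrot]
      exact ⟨EReal.coe_ne_bot _, EReal.coe_ne_top _⟩
    -- `O(1)` has two elements; the smaller of the two values is at most their mean.
    · rcases le_total
        (∫ x, H (Matrix.toEuclideanLin (1 : Matrix (Fin 1) (Fin 1) ℝ).transpose x) ∂μ)
        (∫ x, H (Matrix.toEuclideanLin (-1 : Matrix (Fin 1) (Fin 1) ℝ).transpose x) ∂μ)
        with hle | hle
      · refine ⟨1, h1, fun A hA => ?_, ?_⟩
        · rcases mem_OGrp_one hA with rfl | rfl
          · exact le_rfl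
          · rw [hPhi _ h1, hPhi _ h2, EReal.coe_le_coe_iff]
            exact hle
        · rw [hrot, hPhi _ h1, EReal.coe_le_coe_iff]
          linarith
      · refine ⟨-1, h2, fun A hA => ?_, ?_⟩
        · rcases mem_OGrp_one hA with rfl | rfl
          · rw [hPhi _ h1, hPhi _ h2, EReal.coe_le_coe_iff]
            exact hle
          · exact le_rfl
        · rw [hrot, hPhi _ h2, EReal.coe_le_coe_iff]
          linarith
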